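/- Let $\mathscr{M}$ be a model category with all small colimits which is \emph{good}, meaning that for every small poset $P$ the functor category $\mathrm{Fun}(P,\mathscr{M})$ admits the projective model structure (weak equivalences and fibrations are defined objectwise, cofibrations by the left lifting property with respect to acyclic fibrations). Let $n\ge 0$ and let $P=(\mathbb{R}_{\ge 0})^n$ with the componentwise order. For $\varepsilon\in[0,\infty)$ let $\Lambda_\varepsilon\colon P\to P$ be the translation $(v_1,\dots,v_n)\mapsto(e^{\varepsilon}v_1,\dots,e^{\varepsilon}v_n)$. Functors $F,G\colon P\to\mathscr{M}$ are \emph{$\Lambda_\varepsilon$-interleaved} if there are natural transformations $\phi\colon F\to G\circ\Lambda_\varepsilon$ and $\psi\colon G\to F\circ\Lambda_\varepsilon$ such that, for all $x\in P$, $\psi_{\Lambda_\varepsilon x}\circ\phi_x=F(x\le\Lambda_\varepsilon^2x)$ and $\phi_{\Lambda_\varepsilon x}\circ\psi_x=G(x\le\Lambda_\varepsilon^2x)$. They are \emph{$\Lambda_\varepsilon$-homotopy-interleaved} if there are $\Lambda_\varepsilon$-interleaved functors $F'\simeq F$ and $G'\simeq G$, where $\simeq$ means being connected by a zigzag of objectwise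 weak equivalences. Put $$d^{\Lambda}_H(F,G)=\inf\{\varepsilon\in[0,\infty): F\text{ and }G\text{ are }\Lambda_\varepsilon\text{-homotopy-interleaved}\}\in[0,\infty].$$ The \emph{join-dimension} of $v\in P$ is $0$ if $v$ is minimal; it is $k$ if $v$ is not minimal and is an irredundant join of $k$ join-irreducible elements (an element is join-irreducible if it is not the join of two strictly smaller elements); it is $\infty$ if $v$ is not minimal and has no such decomposition. Let $P_{\le k}\subseteq P$ be the subposet of the elements of join-dimension at most $k$. The \emph{codegree $k$ approximation} $T_kF$ is the homotopy left Kan extension of $F|_{P_{\le k}}$ along the inclusion $P_{\le k}\hookrightarrow P$, i.e. (a functor representing) the value at $F|_{P_{\le k}}$ of the total left derived functor of the left Kan extension functor $\mathrm{Fun}(P_{\le k},\mathscr{M})\to\mathrm{Fun}(P,\mathscr{M})$. Then for all functors $F,G\colon P\to\mathscr{M}$: \begin{enumerate} \item for all integers $k\ge 0$ and all $\varepsilon\ge 0$, if $F$ and $G$ are $\Lambda_\varepsilon$-interleaved, then $T_kF$ and $T_kG$ are $\Lambda_\varepsilon$-homotopy-interleaved; \item for all integers $k\ge 0$, $$d^{\Lambda}_H(T_kF,T_kG)\le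 d^{\Lambda}_H(F,G)\quad\text{and}\quad d^{\Lambda}_H(T_kF,T_kG)\le d^{\Lambda}_H(T_{k+1}F,T_{k+1}G).$$ \end{enumerate} In particular, $d^{\Lambda}_H(T_kF,T_kG)\le d^{\Lambda}_H(T_{k+1}F,T_{k+1}G)\le d^{\Lambda}_H(F,G)$ for all $k\ge 0$. -/

import Mathlib

open CategoryTheory Limits HomotopicalAlgebra
open scoped NNReal ENNReal

universe w v u

namespace PosetCocalculus

/-! ## Good model categories -/

section ModelStructures

variable (P : Type w) [PartialOrder P] (M : Type u) [Category.{v} M] [ModelCategory M]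

/-- The class of objectwise weak equivalences in `Fun(P, M)`. -/
abbrev objWeq : MorphismProperty (P ⥤ M) := (weakEquivalences M).functorCategory P

/-- The class of objectwise fibrations in `Fun(P, M)`. -/
abbrev objFib : MorphismProperty (P ⥤ M) := (fibrations M).functorCategory P

/-- `Fun(P, M)` admits the projective model structure: the objectwise weak equivalences, the
objectwise fibrations, and the natural transformations with the left lifting property with respect
to all objectwise acyclic fibrations satisfy the axioms of a model category. -/
def AdmitsProjectiveModelStructure : Prop :=
  ∃ m : ModelCategory (P ⥤ M),
    m.categoryWithWeakEquivalences.weakEquivalences = objWeq P M ∧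
    m.categoryWithFibrations.fibrations = objFib P M ∧
    m.categoryWithCofibrations.cofibrations = (objFib P M ⊓ objWeq P M).llp

/-- A model category `M` is good (relative to the universe `w` of small sets) if `Fun(P, M)` admits
the projective model structure for all (small) posets `P`. -/
class IsGoodModelCategory (M : Type u) [Category.{v} M] [ModelCategory M] : Prop where
  admits_projective : ∀ (P : Type w) [PartialOrder P], AdmitsProjectiveModelStructure P M

end ModelStructures

/-- Two objects are equivalent, `X ≃ Y`, with respect to a class `W` of weak equivalences if they
are connected by a zigzag of morphisms in `W`. -/
def ZigzagEquiv {C : Type u} [Category.{v} C] (W : MorphismProperty C) (X Y : C) : Prop :=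
  Relation.EqvGen (fun A B => ∃ f : A ⟶ B, W f) X Y

/-! ## Homotopy left Kan extensions -/

section Existence

/-- A functor out of a model category which inverts the weak equivalences between cofibrant objects
has a left derived functor. -/
lemma hasLeftDerivedFunctor_of_cofibrant {C : Type*} [Category* C] [ModelCategory C]
    {H : Type*} [Category* H] (F : C ⥤ H)
    (hF : (weakEquivalences (CofibrantObject C)).IsInvertedBy (CofibrantObject.ι ⋙ F)) :
    F.HasLeftDerivedFunctor (weakEquivalences C) := by
  have key : F.HasPointwiseLeftDerivedFunctor (weakEquivalences C) := by
    intro X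
    let Φ := CofibrantObject.localizerMorphism C
    let R : Φ.LeftResolution X := Classical.arbitrary _
    rw [← F.hasPointwiseLeftDerivedFunctorAt_iff_of_mem _ R.w R.hw]
    let L₁ := (weakEquivalences (CofibrantObject C)).Q
    let L₂ := (weakEquivalences C).Q
    let e := (Φ.catCommSq L₁ L₂).iso
    have h₁ : L₁.HasPointwiseRightKanExtensionAt (CofibrantObject.ι ⋙ F) (L₁.obj R.X₁) := by
      rw [← Functor.hasPointwiseLeftDerivedFunctorAt_iff _ L₁
        (weakEquivalences (CofibrantObject C)) R.X₁]
      exact Functor.hasPointwiseLeftDerivedFunctor_of_inverts _ hF _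
    rw [Functor.hasPointwiseLeftDerivedFunctorAt_iff F L₂ (weakEquivalences C)]
    have h₂ : L₂.HasPointwiseRightKanExtensionAt F
        ((Φ.localizedFunctor L₁ L₂).obj (L₁.obj R.X₁)) := by
      let sq : TwoSquare L₁ Φ.functor (Φ.localizedFunctor L₁ L₂) L₂ := e.inv
      have : (sq.structuredArrowDownwards (L₁.obj R.X₁)).Initial := inferInstance
      have h₃ : HasLimit (sq.structuredArrowDownwards (L₁.obj R.X₁) ⋙
        (StructuredArrow.proj _ L₂ ⋙ F)) := h₁
      exact Functor.Initial.hasLimit_of_comp (sq.structuredArrowDownwards (L₁.obj R.X₁))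
    exact (Functor.hasPointwiseRightKanExtensionAt_iff_of_iso L₂ F (e.app R.X₁)).2 h₂
  infer_instance

/-- A left adjoint functor between model categories whose right adjoint preserves fibrations has a
total left derived functor. -/
lemma hasLeftDerivedFunctor_of_quillen {C D : Type*} [Category* C] [Category* D]
    [ModelCategory C] [ModelCategory D] {F : C ⥤ D} {G : D ⥤ C} (adj : F ⊣ G)
    (hG : ∀ ⦃X Y : D⦄ (f : X ⟶ Y), fibrations D f → fibrations C (G.map f)) :
    (F ⋙ (weakEquivalences D).Q).HasLeftDerivedFunctor (weakEquivalences C) := by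
  have hT : ∀ ⦃X Y : C⦄ (f : X ⟶ Y), trivialCofibrations C f → weakEquivalences D (F.map f) := by
    intro X Y f hf
    have h : (fibrations D).llp (F.map f) := by
      intro A B p hp
      rw [adj.hasLiftingProperty_iff]
      exact MorphismProperty.hasLiftingProperty_of_wfs f _ hf (hG p hp)
    rw [MorphismProperty.llp_eq_of_wfs (trivialCofibrations D) (fibrations D)] at h
    exact h.2
  apply hasLeftDerivedFunctor_of_cofibrant
  intro X Y f hf
  have hf' : WeakEquivalence f.hom := by
    rwa [← weakEquivalence_iff, weakEquivalence_iff_of_objectProperty] at hf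
  obtain ⟨h⟩ : Nonempty (CofibrantBrownFactorization f.hom) := inferInstance
  let L := (weakEquivalences D).Q
  have h₁ : IsIso (L.map (F.map h.i)) := Localization.inverts L (weakEquivalences D) _
    (hT _ ⟨h.hi, mem_weakEquivalences _⟩)
  have h₂ : IsIso (L.map (F.map h.s)) := Localization.inverts L (weakEquivalences D) _
    (hT _ ⟨mem_cofibrations _, mem_weakEquivalences _⟩)
  have h₃ : IsIso (L.map (F.map h.p)) := by
    have : L.map (F.map h.s) ≫ L.map (F.map h.p) = 𝟙 _ := by
      rw [← L.map_comp, ← F.map_comp, h.s_p, F.map_id, L.map_id]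
    exact IsIso.of_isIso_fac_left this
  change IsIso (L.map (F.map f.hom))
  rw [← h.fac, F.map_comp, L.map_comp]
  infer_instance

end Existence

section HoLan

variable {I J : Type w} [PartialOrder I] [PartialOrder J] (α : I →o J)
  (M : Type u) [Category.{v} M] [ModelCategory M] [HasColimitsOfSize.{w, w} M]

/-- The left Kan extension functor `Fun(I, M) ⥤ Fun(J, M)` along a map of posets, followed by the
localization functor to `Ho Fun(J, M)`. -/
noncomputable abbrev lanToHo : (I ⥤ M) ⥤ (objWeq J M).Localization :=
  (α.monotone.functor.lan : (I ⥤ M) ⥤ (J ⥤ M)) ⋙ (objWeq J M).Q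

instance hasLeftDerivedFunctor_lan [IsGoodModelCategory.{w} M] :
    (lanToHo α M).HasLeftDerivedFunctor (objWeq I M) := by
  obtain ⟨mI, hI, hI', -⟩ := IsGoodModelCategory.admits_projective (M := M) I
  obtain ⟨mJ, hJ, hJ', -⟩ := IsGoodModelCategory.admits_projective (M := M) J
  have h := hasLeftDerivedFunctor_of_quillen (α.monotone.functor.lanAdjunction M) (by
    intro X Y f hf
    change mI.categoryWithFibrations.fibrations _
    change mJ.categoryWithFibrations.fibrations _ at hf
    rw [hI']
    rw [hJ'] at hf
    exact fun i => hf (α i))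
  have hI₂ : weakEquivalences (I ⥤ M) = objWeq I M := hI
  have hJ₂ : weakEquivalences (J ⥤ M) = objWeq J M := hJ
  rw [hI₂, hJ₂] at h
  exact h

/-- The homotopy left Kan extension `Ho Fun(I, M) ⥤ Ho Fun(J, M)` along a map of posets: the total
left derived functor of the left Kan extension. -/
noncomputable def hoLan [IsGoodModelCategory.{w} M] :
    (objWeq I M).Localization ⥤ (objWeq J M).Localization :=
  (lanToHo α M).totalLeftDerived (objWeq I M).Q (objWeq I M)

end HoLan

/-! ## Join-dimension and codegree `k` approximations -/

section JoinDimension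

variable {P : Type w} [DistribLattice P]

/-- `v = p 0 ⊔ ⋯ ⊔ p (k - 1)`. -/
def IsJoinDecomposition {k : ℕ} (p : Fin k → P) (v : P) : Prop :=
  IsLUB (Set.range p) v

/-- No member of the join-decomposition `p` of `v` is redundant. (For `k = 1` this says that `v` is
not the least element.) -/
def IsReducedDecomposition {k : ℕ} (p : Fin k → P) (v : P) : Prop :=
  ∀ i, ¬ IsLUB (p '' {j | j ≠ i}) v

/-- An element which is not the join of two strictly smaller elements. A minimal element is
join-irreducible in this sense. -/
def JoinIrreducible (v : P) : Prop :=
  ¬ ∃ x y : P, x < v ∧ y < v ∧ v = x ⊔ y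

open Classical in
/-- The join-dimension of `v`: it is `0` if `v` is minimal, the size of a reduced join-decomposition
of `v` into join-irreducible elements if there is one (it is then unique), and `∞` otherwise. -/
noncomputable def jdim (v : P) : ℕ∞ :=
  if IsMin v then 0
  else ⨅ (k : ℕ) (_ : ∃ p : Fin k → P, IsJoinDecomposition p v ∧ IsReducedDecomposition p v ∧
    ∀ i, JoinIrreducible (p i)), (k : ℕ∞)

variable (P) in
/-- The subposet `P_{≤ k}` of the elements of join-dimension at most `k`. -/
abbrev DimLE (k : ℕ) : Type w := {v : P // jdim v ≤ k}

variable (P) in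
/-- The inclusion of `P_{≤ k}` into `P`. -/
def dimLEIncl (k : ℕ) : DimLE P k →o P := OrderHom.Subtype.val _

/-- The codegree `k` approximation `T_k F` of `F : P ⥤ M`: a functor representing the homotopy left
Kan extension of the restriction of `F` to `P_{≤ k}` along the inclusion of `P_{≤ k}` into `P`.
It is well defined up to isomorphism in `Ho Fun(P, M)`. -/
noncomputable def codegreeApprox {M : Type u} [Category.{v} M] [ModelCategory M]
    [HasColimitsOfSize.{w, w} M] [IsGoodModelCategory.{w} M] (k : ℕ) (F : P ⥤ M) : P ⥤ M :=
  haveI := Localization.essSurj (objWeq P M).Q (objWeq P M)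
  (objWeq P M).Q.objPreimage ((hoLan (dimLEIncl P k) M).obj
    ((objWeq (DimLE P k) M).Q.obj ((dimLEIncl P k).monotone.functor ⋙ F)))

end JoinDimension

/-! ## Interleavings -/

/-- A translation on a poset `P`: an order-preserving map `Γ` with `x ≤ Γ x` for all `x`. -/
structure Translation (P : Type w) [PartialOrder P] extends P →o P where
  le_apply : ∀ x, x ≤ toFun x

namespace Translation

variable {P : Type w} [PartialOrder P]

instance : CoeFun (Translation P) (fun _ => P → P) := ⟨fun Γ => Γ.toOrderHom⟩

/-- A translation, as a functor `P ⥤ P`. -/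
abbrev functor (Γ : Translation P) : P ⥤ P := Γ.toOrderHom.monotone.functor

lemma le_apply_apply (Γ : Translation P) (x : P) : x ≤ Γ (Γ x) :=
  (Γ.le_apply x).trans (Γ.le_apply (Γ x))

end Translation

section Interleaving

variable {P : Type w} [PartialOrder P] {M : Type u} [Category.{v} M]

/-- `F` and `G` are `Γ`-interleaved: there are natural transformations `φ : F ⟶ G ∘ Γ` and
`ψ : G ⟶ F ∘ Γ` whose two composites are the structure maps `F(x ≤ Γ² x)` and `G(x ≤ Γ² x)`. -/
def Interleaved (Γ : Translation P) (F G : P ⥤ M) : Prop :=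
  ∃ (φ : F ⟶ Γ.functor ⋙ G) (ψ : G ⟶ Γ.functor ⋙ F),
    (∀ x, φ.app x ≫ ψ.app (Γ x) = F.map (homOfLE (Γ.le_apply_apply x))) ∧
    (∀ x, ψ.app x ≫ φ.app (Γ x) = G.map (homOfLE (Γ.le_apply_apply x)))

/-- `F` and `G` are `Γ`-homotopy-interleaved: they are equivalent to functors `F'` and `G'` which
are `Γ`-interleaved. -/
def HomotopyInterleaved [ModelCategory M] (Γ : Translation P) (F G : P ⥤ M) : Prop :=
  ∃ F' G' : P ⥤ M, ZigzagEquiv (objWeq P M) F' F ∧ ZigzagEquiv (objWeq P M) G' G ∧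
    Interleaved Γ F' G'

/-- A superlinear family of translations. -/
structure SuperlinearFamily (P : Type w) [PartialOrder P] where
  /-- the translation of parameter `ε ≥ 0` -/
  trans : ℝ≥0 → Translation P
  superlinear : ∀ (ε₁ ε₂ : ℝ≥0) (x : P), trans ε₁ (trans ε₂ x) ≤ trans (ε₁ + ε₂) x

/-- The homotopy interleaving distance: the infimum, in `[0, ∞]`, of all `ε ∈ [0, ∞)` such that `F`
and `G` are `Ω_ε`-homotopy-interleaved (it is `∞` if there is no such `ε`). -/
noncomputable def homotopyInterleavingDist [ModelCategory M] (Ω : SuperlinearFamily P)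
    (F G : P ⥤ M) : ℝ≥0∞ :=
  ⨅ (ε : ℝ≥0) (_ : HomotopyInterleaved (Ω.trans ε) F G), (ε : ℝ≥0∞)

end Interleaving

/-! ## The multiplicative interleaving distance -/

/-- The set `(ℝ≥0)ⁿ`. -/
def Orthant (n : ℕ) : Type := Fin n → ℝ≥0

/-- The componentwise order on `(ℝ≥0)ⁿ`. -/
noncomputable instance (n : ℕ) : DistribLattice (Orthant n) :=
  inferInstanceAs (DistribLattice (Fin n → ℝ≥0))

/-- The exponential `e ^ ε` of `ε ≥ 0`, as a nonnegative real number. -/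
noncomputable def expNN (ε : ℝ≥0) : ℝ≥0 := ⟨Real.exp ε, (Real.exp_pos _).le⟩

lemma one_le_expNN (ε : ℝ≥0) : 1 ≤ expNN ε :=
  NNReal.coe_le_coe.1 (Real.one_le_exp ε.2)

lemma expNN_add (a b : ℝ≥0) : expNN (a + b) = expNN a * expNN b :=
  NNReal.eq (Real.exp_add a b)

/-- The superlinear family `Λ` on `(ℝ≥0)ⁿ`: `Λ_ε (v₁, …, vₙ) = (v₁ e^ε, …, vₙ e^ε)`. -/
noncomputable def multFamily (n : ℕ) : SuperlinearFamily (Orthant n) where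
  trans ε :=
    { toFun := fun v i => v i * expNN ε
      monotone' := fun _ _ h i => mul_le_mul_left (h i) (expNN ε)
      le_apply := fun v i => le_mul_of_one_le_right zero_le (one_le_expNN ε) }
  superlinear ε₁ ε₂ v := fun i => by
    change v i * expNN ε₂ * expNN ε₁ ≤ v i * expNN (ε₁ + ε₂)
    rw [expNN_add, mul_assoc, mul_comm (expNN ε₂)]

/-- The multiplicative homotopy interleaving distance `d^Λ_H`. -/
noncomputable def multDist {n : ℕ} {M : Type u} [Category.{v} M] [ModelCategory M]
    (F G : Orthant n ⥤ M) : ℝ≥0∞ :=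
  homotopyInterleavingDist (multFamily n) F G

end PosetCocalculus

open PosetCocalculus

/-!
The approximation `T_k F` is the left Kan extension of any projectively cofibrant functor equivalent
to `F|P_{≤ k}` (`codegreeApprox_zigzagEquiv_lan`). This rests on two facts about model categories:
the counit of a left derived functor is invertible at cofibrant objects
(`isIso_leftDerivedFunctor_app_of_isCofibrant`), and objects which become isomorphic in the homotopy
category are connected by a zigzag of weak equivalences (`zigzagEquiv_of_iso`).

The factorizations of a model category need not be functorial, so `F` and `G` cannot be replaced by
cofibrant functors separately without losing the strict interleaving. Instead, a `Γ`-interleaving is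
encoded as one functor on a poset `J` (`InterleavingPoset Γ`) which contains two copies of `P`, and
this functor is resolved at once. Each inclusion `i : P → J` has a left adjoint `r : J → P`, so that
restriction along `i` is left adjoint to restriction along `r`. Hence restriction along `i` preserves
projectively cofibrant functors (`ProjCofibrant.restrict`) and commutes with left Kan extension
(`lanBaseChangeIso`). As `Λ_ε` is an automorphism of the lattice `P`, it preserves `P_{≤ k}`; so the
left Kan extension of the resolved interleaving of `F|P_{≤ k}` and `G|P_{≤ k}` along the map of
interleaving posets induced by `P_{≤ k} → P` is an interleaving of functors equivalent to `T_k F` and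
`T_k G` (`exists_projCofibrant_interleaved_lan`).

The inclusion of `P_{≤ k + 1}` is full, hence `T_{k+1} F` restricts to `F` on `P_{≤ k + 1}` up to
equivalence, and `T_k T_{k+1} F ≃ T_k F` (`codegreeApprox_codegreeApprox`). The comparison of the
distances for `k` and `k + 1` is therefore the comparison for `T_{k+1} F` and `T_{k+1} G`.
-/

namespace PosetCocalculus

/-! ### Zigzags of weak equivalences -/

section ZigzagEquiv

variable {C : Type*} [Category* C] {W : MorphismProperty C}

lemma ZigzagEquiv.symm {X Y : C} (h : ZigzagEquiv W X Y) : ZigzagEquiv W Y X :=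
  Relation.EqvGen.symm _ _ h

lemma ZigzagEquiv.trans {X Y Z : C} (h : ZigzagEquiv W X Y) (h' : ZigzagEquiv W Y Z) :
    ZigzagEquiv W X Z :=
  Relation.EqvGen.trans _ _ _ h h'

lemma ZigzagEquiv.of_hom {X Y : C} (f : X ⟶ Y) (hf : W f) : ZigzagEquiv W X Y :=
  Relation.EqvGen.rel _ _ ⟨f, hf⟩

lemma ZigzagEquiv.map {D : Type*} [Category* D] {W' : MorphismProperty D} (F : C ⥤ D)
    (hF : W ≤ W'.inverseImage F) {X Y : C} (h : ZigzagEquiv W X Y) :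
    ZigzagEquiv W' (F.obj X) (F.obj Y) := by
  induction h with
  | rel _ _ h =>
    obtain ⟨f, hf⟩ := h
    exact .of_hom (F.map f) (hF f hf)
  | refl _ => exact Relation.EqvGen.refl _
  | symm _ _ _ ih => exact ih.symm
  | trans _ _ _ _ _ ih ih' => exact ih.trans ih'

lemma ZigzagEquiv.nonempty_iso {D : Type*} [Category* D] (F : C ⥤ D) (hF : W.IsInvertedBy F)
    {X Y : C} (h : ZigzagEquiv W X Y) : Nonempty (F.obj X ≅ F.obj Y) := by
  induction h with
  | rel _ _ h =>
    obtain ⟨f, hf⟩ := h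
    have := hF f hf
    exact ⟨asIso (F.map f)⟩
  | refl _ => exact ⟨Iso.refl _⟩
  | symm _ _ _ ih => exact ⟨ih.some.symm⟩
  | trans _ _ _ _ _ ih ih' => exact ⟨ih.some ≪≫ ih'.some⟩

end ZigzagEquiv

/-! ### Isomorphisms in the homotopy category of a model category -/

section Saturation

variable {C : Type*} [Category* C] [ModelCategory C] {H : Type*} [Category* H]
  (L : C ⥤ H) [L.IsLocalization (weakEquivalences C)]

/-- A fibration between bifibrant objects which becomes invertible in the homotopy category is a
weak equivalence: the covering homotopy theorem provides a strict section `s` of `p`, and `p` is a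
retract of `p ≫ s`, which is homotopic to the identity. -/
lemma weakEquivalence_of_isIso_map_of_fibration {X Y : C} [IsCofibrant X] [IsFibrant X]
    [IsCofibrant Y] [IsFibrant Y] (p : X ⟶ Y) [Fibration p] [IsIso (L.map p)] :
    WeakEquivalence p := by
  obtain ⟨s₀, hs₀⟩ := map_surjective_of_isLocalization L Y X (inv (L.map p))
  have h₀ : LeftHomotopyRel (s₀ ≫ p) (𝟙 Y) := by
    rw [LeftHomotopyRel.iff_map_eq L]
    simp [hs₀]
  obtain ⟨P, _, ⟨h⟩⟩ := h₀.exists_good_cylinder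
  obtain ⟨s, h', hs⟩ := h.covering_homotopy p s₀
  have hsp : s ≫ p = 𝟙 Y := by rw [← h'.h₁, Category.assoc, hs, h.h₁]
  have hs' : L.map s = inv (L.map p) := by
    rw [← hs₀, ← LeftHomotopyRel.iff_map_eq L]
    exact h'.leftHomotopyRel.symm
  have h₁ : LeftHomotopyRel (p ≫ s) (𝟙 X) := by
    rw [LeftHomotopyRel.iff_map_eq L]
    simp [hs']
  obtain ⟨Q, ⟨k⟩⟩ := h₁
  have : WeakEquivalence (p ≫ s) := k.weakEquivalence_iff.2 inferInstance
  have r : RetractArrow p (p ≫ s) :=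
    { i := Arrow.homMk (𝟙 X) s
      r := Arrow.homMk (𝟙 X) p (by simp [hsp])
      retract := by ext <;> simp [hsp] }
  rw [weakEquivalence_iff] at this ⊢
  exact MorphismProperty.of_retract r this

/-- A morphism between bifibrant objects which becomes invertible in the homotopy category is a
weak equivalence. -/
lemma weakEquivalence_of_isIso_map {X Y : C} [IsCofibrant X] [IsFibrant X]
    [IsCofibrant Y] [IsFibrant Y] (f : X ⟶ Y) [IsIso (L.map f)] :
    WeakEquivalence f := by
  let h := MorphismProperty.factorizationData (trivialCofibrations C) (fibrations C) f
  have : IsCofibrant h.Z := isCofibrant_of_cofibration h.i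
  have : IsFibrant h.Z := isFibrant_of_fibration h.p
  have : IsIso (L.map h.i) := Localization.inverts L (weakEquivalences C) _
    (mem_weakEquivalences h.i)
  have : IsIso (L.map h.p) := by
    have : IsIso (L.map h.i ≫ L.map h.p) := by
      rw [← L.map_comp, h.fac]
      infer_instance
    exact IsIso.of_isIso_comp_left (L.map h.i) (L.map h.p)
  have := weakEquivalence_of_isIso_map_of_fibration L h.p
  rw [← h.fac]
  infer_instance

/-- Every object is weakly equivalent to a bifibrant one: a cofibrant resolution, followed by a
fibrant replacement of it. -/
lemma exists_bifibrant_zigzagEquiv (X : C) :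
    ∃ (Y : C) (_ : IsCofibrant Y) (_ : IsFibrant Y), ZigzagEquiv (weakEquivalences C) X Y := by
  obtain ⟨X', _, p, _, _⟩ := CofibrantObject.HoCat.exists_resolution X
  obtain ⟨Y, i, _, hi⟩ := CofibrantObject.exists_bifibrant (.mk X')
  refine ⟨Y.obj, inferInstance, inferInstance, ?_⟩
  exact (ZigzagEquiv.of_hom p (mem_weakEquivalences p)).symm.trans
    (ZigzagEquiv.of_hom i.hom ((weakEquivalence_iff _).1 hi))

/-- Objects of a model category which are isomorphic in the homotopy category are connected by a
zigzag of weak equivalences. -/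
lemma zigzagEquiv_of_iso {X Y : C} (e : L.obj X ≅ L.obj Y) :
    ZigzagEquiv (weakEquivalences C) X Y := by
  obtain ⟨X', _, _, hX⟩ := exists_bifibrant_zigzagEquiv X
  obtain ⟨Y', _, _, hY⟩ := exists_bifibrant_zigzagEquiv Y
  obtain ⟨eX⟩ := hX.nonempty_iso L (Localization.inverts L _)
  obtain ⟨eY⟩ := hY.nonempty_iso L (Localization.inverts L _)
  obtain ⟨f, hf⟩ := map_surjective_of_isLocalization L X' Y' (eX.symm ≪≫ e ≪≫ eY).hom
  have : IsIso (L.map f) := by rw [hf]; infer_instance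
  have := weakEquivalence_of_isIso_map L f
  exact hX.trans ((ZigzagEquiv.of_hom f (mem_weakEquivalences f)).trans hY.symm)

end Saturation

/-! ### Left derived functors at cofibrant objects -/

section LeftDerived

/-- If `F` inverts `W` and `L` is a localization functor for `W`, then the limit over
`StructuredArrow (L.obj X) L` which computes the left derived functor of `F` at `X` is `F.obj X`. -/
lemma isIso_π_app_mk_id {C D H : Type*} [Category* C] [Category* D] [Category* H]
    {W : MorphismProperty C} (L : C ⥤ D) [L.IsLocalization W] {F : C ⥤ H}
    (hF : W.IsInvertedBy F) (X : C) {c : Cone (StructuredArrow.proj (L.obj X) L ⋙ F)}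
    (hc : IsLimit c) : IsIso (c.π.app (StructuredArrow.mk (𝟙 (L.obj X)))) := by
  let e := Localization.fac F hF L
  let h := Functor.isPointwiseRightKanExtensionAtOfIsoOfIsLocalization W e.symm X
  have h₁ : c.π.app (StructuredArrow.mk (𝟙 (L.obj X))) =
      (hc.conePointUniqueUpToIso h).hom ≫ e.hom.app X := by
    rw [← hc.conePointUniqueUpToIso_hom_comp h (StructuredArrow.mk (𝟙 (L.obj X)))]
    congr 1
    change (Localization.lift F hF L).map (𝟙 (L.obj X)) ≫ e.hom.app X = e.hom.app X
    rw [CategoryTheory.Functor.map_id]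
    exact Category.id_comp _
  rw [h₁]
  exact IsIso.comp_isIso' inferInstance (inferInstanceAs (IsIso (e.hom.app X)))

variable {C : Type*} [Category* C] [ModelCategory C] {H : Type*} [Category* H]

/-- A functor which inverts the weak equivalences between cofibrant objects has a pointwise left
derived functor: the cofibrant objects form a left derivability structure, so the defining limits
can be computed in the category of cofibrant objects. -/
lemma hasPointwiseLeftDerivedFunctor_of_cofibrant (F : C ⥤ H)
    (hF : (weakEquivalences (CofibrantObject C)).IsInvertedBy (CofibrantObject.ι ⋙ F)) :
    F.HasPointwiseLeftDerivedFunctor (weakEquivalences C) := by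
  intro X
  let Φ := CofibrantObject.localizerMorphism C
  let R : Φ.LeftResolution X := Classical.arbitrary _
  rw [← F.hasPointwiseLeftDerivedFunctorAt_iff_of_mem _ R.w R.hw]
  let L₁ := (weakEquivalences (CofibrantObject C)).Q
  let L₂ := (weakEquivalences C).Q
  let e := (Φ.catCommSq L₁ L₂).iso
  have h₁ : L₁.HasPointwiseRightKanExtensionAt (CofibrantObject.ι ⋙ F) (L₁.obj R.X₁) := by
    rw [← Functor.hasPointwiseLeftDerivedFunctorAt_iff _ L₁
      (weakEquivalences (CofibrantObject C)) R.X₁]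
    exact Functor.hasPointwiseLeftDerivedFunctor_of_inverts _ hF _
  rw [Functor.hasPointwiseLeftDerivedFunctorAt_iff F L₂ (weakEquivalences C)]
  have h₂ : L₂.HasPointwiseRightKanExtensionAt F
      ((Φ.localizedFunctor L₁ L₂).obj (L₁.obj R.X₁)) := by
    let sq : TwoSquare L₁ Φ.functor (Φ.localizedFunctor L₁ L₂) L₂ := e.inv
    have : (sq.structuredArrowDownwards (L₁.obj R.X₁)).Initial := inferInstance
    have h₃ : HasLimit (sq.structuredArrowDownwards (L₁.obj R.X₁) ⋙
      (StructuredArrow.proj _ L₂ ⋙ F)) := h₁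
    exact Functor.Initial.hasLimit_of_comp (sq.structuredArrowDownwards (L₁.obj R.X₁))
  exact (Functor.hasPointwiseRightKanExtensionAt_iff_of_iso L₂ F (e.app R.X₁)).2 h₂

/-- If `F` inverts the weak equivalences between cofibrant objects, then the counit of a left
derived functor of `F` is an isomorphism at every cofibrant object. -/
lemma isIso_leftDerivedFunctor_app_of_isCofibrant {F : C ⥤ H}
    (hF : (weakEquivalences (CofibrantObject C)).IsInvertedBy (CofibrantObject.ι ⋙ F))
    {W : MorphismProperty C} (hW : weakEquivalences C = W)
    {D : Type*} [Category* D] (L₂ : C ⥤ D) [L₂.IsLocalization W]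
    (LF : D ⥤ H) (α : L₂ ⋙ LF ⟶ F) [LF.IsLeftDerivedFunctor α W]
    (X : C) [IsCofibrant X] : IsIso (α.app X) := by
  subst hW
  have := hasPointwiseLeftDerivedFunctor_of_cofibrant F hF
  let Φ := CofibrantObject.localizerMorphism C
  let L₁ := (weakEquivalences (CofibrantObject C)).Q
  let e := (Φ.catCommSq L₁ L₂).iso
  let X₁ : CofibrantObject C := .mk X
  -- The value of `LF` at `X` is a limit over a category in which the arrows from cofibrant objects
  -- are initial; its restriction to these is computed by `isIso_π_app_mk_id`.
  let h := Functor.isPointwiseRightKanExtensionOfHasPointwiseLeftDerivedFunctor LF α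
    (weakEquivalences C) ((Φ.localizedFunctor L₁ L₂).obj (L₁.obj X₁))
  let sq : TwoSquare L₁ Φ.functor (Φ.localizedFunctor L₁ L₂) L₂ := e.inv
  have : (sq.structuredArrowDownwards (L₁.obj X₁)).Initial := inferInstance
  have h' := (Functor.Initial.isLimitWhiskerEquiv (sq.structuredArrowDownwards (L₁.obj X₁)) _).symm h
  have h₁ := isIso_π_app_mk_id L₁ hF X₁ h'
  let g := (sq.structuredArrowDownwards (L₁.obj X₁)).obj (StructuredArrow.mk (𝟙 (L₁.obj X₁)))
  have hg : g.hom = e.inv.app X₁ := by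
    change (Φ.localizedFunctor L₁ L₂).map (𝟙 (L₁.obj X₁)) ≫ e.inv.app X₁ = e.inv.app X₁
    rw [CategoryTheory.Functor.map_id]
    exact Category.id_comp _
  have h₂ : IsIso (LF.map g.hom ≫ α.app X) := h₁
  have : IsIso g.hom := by
    rw [hg]
    exact NatIso.inv_app_isIso e X₁
  exact IsIso.of_isIso_comp_left (LF.map g.hom) (α.app X)

/-- A left adjoint functor whose right adjoint preserves fibrations sends weak equivalences between
cofibrant objects to isomorphisms of the homotopy category. -/
lemma isInvertedBy_of_quillen {D : Type*} [Category* D]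
    [ModelCategory D] {F : C ⥤ D} {G : D ⥤ C} (adj : F ⊣ G)
    (hG : ∀ ⦃X Y : D⦄ (f : X ⟶ Y), fibrations D f → fibrations C (G.map f)) :
    (weakEquivalences (CofibrantObject C)).IsInvertedBy
      (CofibrantObject.ι ⋙ F ⋙ (weakEquivalences D).Q) := by
  have hT : ∀ ⦃X Y : C⦄ (f : X ⟶ Y), trivialCofibrations C f → weakEquivalences D (F.map f) := by
    intro X Y f hf
    have h : (fibrations D).llp (F.map f) := by
      intro A B p hp
      rw [adj.hasLiftingProperty_iff]
      exact MorphismProperty.hasLiftingProperty_of_wfs f _ hf (hG p hp)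
    rw [MorphismProperty.llp_eq_of_wfs (trivialCofibrations D) (fibrations D)] at h
    exact h.2
  intro X Y f hf
  have hf' : WeakEquivalence f.hom := by
    rwa [← weakEquivalence_iff, weakEquivalence_iff_of_objectProperty] at hf
  obtain ⟨h⟩ : Nonempty (CofibrantBrownFactorization f.hom) := inferInstance
  let L := (weakEquivalences D).Q
  have h₁ : IsIso (L.map (F.map h.i)) := Localization.inverts L (weakEquivalences D) _
    (hT _ ⟨h.hi, mem_weakEquivalences _⟩)
  have h₂ : IsIso (L.map (F.map h.s)) := Localization.inverts L (weakEquivalences D) _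
    (hT _ ⟨mem_cofibrations _, mem_weakEquivalences _⟩)
  have h₃ : IsIso (L.map (F.map h.p)) := by
    have : L.map (F.map h.s) ≫ L.map (F.map h.p) = 𝟙 _ := by
      rw [← L.map_comp, ← F.map_comp, h.s_p, F.map_id, L.map_id]
    exact IsIso.of_isIso_fac_left this
  change IsIso (L.map (F.map f.hom))
  rw [← h.fac, F.map_comp, L.map_comp]
  infer_instance

end LeftDerived

/-! ### Projectively cofibrant functors -/

section Projective

variable {P : Type w} [PartialOrder P] {M : Type u} [Category.{v} M] [ModelCategory M]

lemma objWeq_of_isIso {X Y : P ⥤ M} (f : X ⟶ Y) [IsIso f] : objWeq P M f :=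
  fun i => mem_weakEquivalences (f.app i)

lemma ZigzagEquiv.of_iso {X Y : P ⥤ M} (e : X ≅ Y) : ZigzagEquiv (objWeq P M) X Y :=
  .of_hom e.hom (objWeq_of_isIso e.hom)

/-- Restriction along a map of posets preserves zigzags of objectwise weak equivalences. -/
lemma ZigzagEquiv.restrict {S : Type w} [PartialOrder S] (α : S →o P) {X Y : P ⥤ M}
    (h : ZigzagEquiv (objWeq P M) X Y) :
    ZigzagEquiv (objWeq S M) (α.monotone.functor ⋙ X) (α.monotone.functor ⋙ Y) :=
  h.map (W' := objWeq S M) ((Functor.whiskeringLeft _ _ M).obj α.monotone.functor)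
    (fun _ _ _ hf i => hf (α i))

/-- The cofibrant objects of the projective model structure on `Fun(P, M)`, described by the lifting
property against objectwise acyclic fibrations. -/
def ProjCofibrant (X : P ⥤ M) : Prop :=
  ∀ ⦃A B : P ⥤ M⦄ (p : A ⟶ B), objFib P M p → objWeq P M p →
    ∀ g : X ⟶ B, ∃ h : X ⟶ A, h ≫ p = g

/-- A left adjoint functor preserves projectively cofibrant objects if its right adjoint preserves
objectwise acyclic fibrations. -/
lemma ProjCofibrant.of_adjunction {S : Type w} [PartialOrder S] {F : (P ⥤ M) ⥤ (S ⥤ M)}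
    {G : (S ⥤ M) ⥤ (P ⥤ M)} (adj : F ⊣ G)
    (hG : ∀ ⦃A B : S ⥤ M⦄ (p : A ⟶ B), objFib S M p → objWeq S M p →
      objFib P M (G.map p) ∧ objWeq P M (G.map p))
    {X : P ⥤ M} (hX : ProjCofibrant X) : ProjCofibrant (F.obj X) := by
  intro A B p hp hp' g
  obtain ⟨h, hh⟩ := hX (G.map p) (hG p hp hp').1 (hG p hp hp').2 (adj.homEquiv _ _ g)
  refine ⟨(adj.homEquiv _ _).symm h, ?_⟩
  rw [← adj.homEquiv_naturality_right_symm, hh, Equiv.symm_apply_apply]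

lemma ProjCofibrant.isCofibrant [m : ModelCategory (P ⥤ M)]
    (hc : cofibrations (P ⥤ M) = (objFib P M ⊓ objWeq P M).llp) {X : P ⥤ M}
    (hX : ProjCofibrant X) : IsCofibrant X := by
  rw [isCofibrant_iff, cofibration_iff, hc]
  intro A B p hp
  refine ⟨fun {f g} sq => ?_⟩
  obtain ⟨h, hh⟩ := hX p hp.1 hp.2 g
  exact ⟨⟨{ l := h, fac_left := initialIsInitial.hom_ext _ _, fac_right := hh }⟩⟩

lemma ProjCofibrant.of_isCofibrant [m : ModelCategory (P ⥤ M)]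
    (hc : cofibrations (P ⥤ M) = (objFib P M ⊓ objWeq P M).llp) {X : P ⥤ M}
    [IsCofibrant X] : ProjCofibrant X := by
  intro A B p hp hp' g
  have h : cofibrations (P ⥤ M) (initial.to X) := mem_cofibrations _
  rw [hc] at h
  have := h p ⟨hp, hp'⟩
  have sq : CommSq (initial.to A) (initial.to X) p g := ⟨initialIsInitial.hom_ext _ _⟩
  exact ⟨sq.lift, sq.fac_right⟩

variable [IsGoodModelCategory.{w} M]

lemma exists_projCofibrant_resolution (F : P ⥤ M) :
    ∃ (X : P ⥤ M) (p : X ⟶ F), ProjCofibrant X ∧ objWeq P M p := by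
  obtain ⟨m, hw, -, hc⟩ := IsGoodModelCategory.admits_projective (M := M) P
  obtain ⟨X, _, p, _, hp⟩ := CofibrantObject.HoCat.exists_resolution F
  refine ⟨X, p, .of_isCofibrant hc, ?_⟩
  rw [← hw]
  exact (weakEquivalence_iff p).1 hp

/-- Functors which are isomorphic in `Ho Fun(P, M)` are connected by a zigzag of objectwise weak
equivalences. -/
lemma zigzagEquiv_of_iso_Q {X Y : P ⥤ M} (e : (objWeq P M).Q.obj X ≅ (objWeq P M).Q.obj Y) :
    ZigzagEquiv (objWeq P M) X Y := by
  obtain ⟨m, hw, -, -⟩ := IsGoodModelCategory.admits_projective (M := M) P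
  have hw' : weakEquivalences (P ⥤ M) = objWeq P M := hw
  have : (objWeq P M).Q.IsLocalization (weakEquivalences (P ⥤ M)) := by
    rw [hw']
    infer_instance
  have h := zigzagEquiv_of_iso (objWeq P M).Q e
  rwa [hw'] at h

/-- On projectively cofibrant functors, the homotopy left Kan extension is computed by the left Kan
extension. -/
lemma nonempty_hoLan_iso [HasColimitsOfSize.{w, w} M] {S : Type w} [PartialOrder S] (α : S →o P)
    {X : S ⥤ M} (hX : ProjCofibrant X) :
    Nonempty ((hoLan α M).obj ((objWeq S M).Q.obj X) ≅
      (objWeq P M).Q.obj (α.monotone.functor.lan.obj X)) := by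
  let β : (objWeq S M).Q ⋙ hoLan α M ⟶ lanToHo α M :=
    (lanToHo α M).totalLeftDerivedCounit (objWeq S M).Q (objWeq S M)
  have hβ : (hoLan α M).IsLeftDerivedFunctor β (objWeq S M) := by
    dsimp only [hoLan, β]
    infer_instance
  obtain ⟨mS, hS, hS', hS''⟩ := IsGoodModelCategory.admits_projective (M := M) S
  obtain ⟨mP, hP, hP', -⟩ := IsGoodModelCategory.admits_projective (M := M) P
  have hinv := isInvertedBy_of_quillen (α.monotone.functor.lanAdjunction M) (by
    intro X Y f hf
    change mS.categoryWithFibrations.fibrations _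
    change mP.categoryWithFibrations.fibrations _ at hf
    rw [hS']
    rw [hP'] at hf
    exact fun i => hf (α i))
  have hS₂ : weakEquivalences (S ⥤ M) = objWeq S M := hS
  have hP₂ : weakEquivalences (P ⥤ M) = objWeq P M := hP
  rw [hP₂] at hinv
  have := hX.isCofibrant hS''
  have := isIso_leftDerivedFunctor_app_of_isCofibrant hinv hS₂ (objWeq S M).Q (hoLan α M) β X
  exact ⟨asIso (β.app X)⟩

end Projective

/-! ### Codegree approximations -/

section CodegreeApprox

variable {P : Type w} [DistribLattice P] {M : Type u} [Category.{v} M] [ModelCategory M]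
  [HasColimitsOfSize.{w, w} M] [IsGoodModelCategory.{w} M]

/-- `T_k F` is the left Kan extension of any projectively cofibrant functor equivalent to the
restriction of `F` to `P_{≤ k}`. -/
lemma codegreeApprox_zigzagEquiv_lan (k : ℕ) (F : P ⥤ M) {X : DimLE P k ⥤ M}
    (hX : ProjCofibrant X)
    (hXF : ZigzagEquiv (objWeq _ M) X ((dimLEIncl P k).monotone.functor ⋙ F)) :
    ZigzagEquiv (objWeq P M) (codegreeApprox k F)
      ((dimLEIncl P k).monotone.functor.lan.obj X) := by
  have := Localization.essSurj (objWeq P M).Q (objWeq P M)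
  obtain ⟨e₁⟩ := nonempty_hoLan_iso (dimLEIncl P k) hX
  obtain ⟨e₂⟩ := hXF.nonempty_iso (objWeq (DimLE P k) M).Q (Localization.inverts _ _)
  exact zigzagEquiv_of_iso_Q ((objWeq P M).Q.objObjPreimageIso _ ≪≫
    (hoLan (dimLEIncl P k) M).mapIso e₂.symm ≪≫ e₁)

/-- Up to equivalence, `T_k F` depends only on the restriction of `F` to `P_{≤ k}`. -/
lemma codegreeApprox_congr_of_restrict (k : ℕ) {F G : P ⥤ M}
    (h : ZigzagEquiv (objWeq _ M) ((dimLEIncl P k).monotone.functor ⋙ F)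
      ((dimLEIncl P k).monotone.functor ⋙ G)) :
    ZigzagEquiv (objWeq P M) (codegreeApprox k F) (codegreeApprox k G) := by
  obtain ⟨X, p, hX, hp⟩ := exists_projCofibrant_resolution ((dimLEIncl P k).monotone.functor ⋙ F)
  exact (codegreeApprox_zigzagEquiv_lan k F hX (.of_hom p hp)).trans
    (codegreeApprox_zigzagEquiv_lan k G hX ((ZigzagEquiv.of_hom p hp).trans h)).symm

lemma codegreeApprox_congr (k : ℕ) {F G : P ⥤ M} (h : ZigzagEquiv (objWeq P M) F G) :
    ZigzagEquiv (objWeq P M) (codegreeApprox k F) (codegreeApprox k G) :=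
  codegreeApprox_congr_of_restrict k (h.restrict (dimLEIncl P k))

/-- `T_k F` restricts to `F` on `P_{≤ k}`, because the inclusion of `P_{≤ k}` is full. -/
lemma codegreeApprox_restrict (k : ℕ) (F : P ⥤ M) :
    ZigzagEquiv (objWeq _ M) ((dimLEIncl P k).monotone.functor ⋙ codegreeApprox k F)
      ((dimLEIncl P k).monotone.functor ⋙ F) := by
  obtain ⟨X, p, hX, hp⟩ := exists_projCofibrant_resolution ((dimLEIncl P k).monotone.functor ⋙ F)
  have h := codegreeApprox_zigzagEquiv_lan k F hX (.of_hom p hp)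
  have : (dimLEIncl P k).monotone.functor.Full := ⟨fun f => ⟨homOfLE (leOfHom f), rfl⟩⟩
  have : (dimLEIncl P k).monotone.functor.Faithful := ⟨fun _ => Subsingleton.elim _ _⟩
  have e : X ≅ (dimLEIncl P k).monotone.functor ⋙ (dimLEIncl P k).monotone.functor.lan.obj X :=
    asIso ((dimLEIncl P k).monotone.functor.lanUnit.app X)
  exact (h.restrict (dimLEIncl P k)).trans
    ((ZigzagEquiv.of_iso e).symm.trans (.of_hom p hp))

/-- `T_k T_l F ≃ T_k F` for `k ≤ l`. -/
lemma codegreeApprox_codegreeApprox {k l : ℕ} (hkl : k ≤ l) (F : P ⥤ M) :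
    ZigzagEquiv (objWeq P M) (codegreeApprox k (codegreeApprox l F)) (codegreeApprox k F) := by
  let j : DimLE P k →o DimLE P l :=
    { toFun := fun v => ⟨v.1, v.2.trans (Nat.cast_le.2 hkl)⟩
      monotone' := fun _ _ h => h }
  exact codegreeApprox_congr_of_restrict k ((codegreeApprox_restrict l F).restrict j)

end CodegreeApprox

/-! ### Base change along Galois connections -/

section BaseChange

variable {P S J K : Type w} [PartialOrder P] [PartialOrder S] [PartialOrder J] [PartialOrder K]
  {M : Type u} [Category.{v} M]

/-- Restriction along the right adjoint `i` of a Galois connection is left adjoint to restriction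
along its left adjoint `r`. -/
noncomputable def restrictAdjunction {r : J →o P} {i : P →o J} (gc : GaloisConnection r i) :
    (Functor.whiskeringLeft _ _ M).obj i.monotone.functor ⊣
      (Functor.whiskeringLeft _ _ M).obj r.monotone.functor :=
  gc.adjunction.whiskerLeft M

lemma ProjCofibrant.restrict [ModelCategory M] {r : J →o P} {i : P →o J}
    (gc : GaloisConnection r i) {X : J ⥤ M} (hX : ProjCofibrant X) :
    ProjCofibrant (i.monotone.functor ⋙ X) :=
  hX.of_adjunction (restrictAdjunction gc) (fun _ _ _ h h' => ⟨fun z => h (r z), fun z => h' (r z)⟩)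

/-- The base change isomorphism between left Kan extensions, for a morphism of Galois connections:
both sides are left adjoint to the same restriction functor. -/
noncomputable def lanBaseChangeIso [HasColimitsOfSize.{w, w} M] {α : S →o P} {β : K →o J}
    {r : J →o P} {i : P →o J} (gc : GaloisConnection r i)
    {r' : K →o S} {i' : S →o K} (gc' : GaloisConnection r' i')
    (comm : ∀ z, r (β z) = α (r' z)) (X : K ⥤ M) :
    i.monotone.functor ⋙ β.monotone.functor.lan.obj X ≅
      α.monotone.functor.lan.obj (i'.monotone.functor ⋙ X) :=
  let adj₁ := (β.monotone.functor.lanAdjunction M).comp (restrictAdjunction gc)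
  let adj₂ := (restrictAdjunction gc').comp (α.monotone.functor.lanAdjunction M)
  let e : β.monotone.functor ⋙ r.monotone.functor ≅ r'.monotone.functor ⋙ α.monotone.functor :=
    NatIso.ofComponents (fun z => eqToIso (comm z)) (fun _ => Subsingleton.elim _ _)
  ((adj₁.ofNatIsoRight ((Functor.whiskeringLeft _ _ M).mapIso e)).leftAdjointUniq adj₂).app X

end BaseChange

/-! ### The poset which classifies interleavings -/

section InterleavingPoset

variable {P : Type w} [PartialOrder P] (Γ : Translation P) {M : Type u} [Category.{v} M]

/-- The preorder which classifies `Γ`-interleavings: two copies of `P`, with `x` in one copy below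
`y` in the other copy if and only if `Γ x ≤ y`. It is not a partial order in general: the two copies
of a fixed point of `Γ` are below each other. -/
inductive InterleavingPreorder (_Γ : Translation P) : Type w
  /-- an element of the first copy of `P` -/
  | inl (x : P)
  /-- an element of the second copy of `P` -/
  | inr (x : P)

namespace InterleavingPreorder

variable {Γ}

/-- For `z` in either copy of `P`, the least elements of the first and of the second copy of `P`
which are above `z`. -/
def toProd : InterleavingPreorder Γ → P × P
  | inl x => (x, Γ x)
  | inr x => (Γ x, x)

instance : Preorder (InterleavingPreorder Γ) := Preorder.lift toProd

/-- Compatibility with composition of a path `x ≤ y` in one copy of `P`, then to `z` in the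
other. -/
lemma naturality_of_le {F G : P ⥤ M} (φ : F ⟶ Γ.functor ⋙ G) {x y z : P} (hxy : x ≤ y)
    (hyz : Γ y ≤ z) (hxz : Γ x ≤ z) :
    φ.app x ≫ G.map (homOfLE hxz) = F.map (homOfLE hxy) ≫ φ.app y ≫ G.map (homOfLE hyz) := by
  refine Eq.trans ?_ (φ.naturality_assoc (homOfLE hxy) _).symm
  exact congrArg (φ.app x ≫ ·) (G.map_comp (Γ.functor.map (homOfLE hxy)) (homOfLE hyz))

/-- Compatibility with composition of a path from `x` to `y` in the other copy of `P` and back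
to `z`. -/
lemma comp_of_le {F G : P ⥤ M} (φ : F ⟶ Γ.functor ⋙ G) (ψ : G ⟶ Γ.functor ⋙ F)
    (h : ∀ x, φ.app x ≫ ψ.app (Γ x) = F.map (homOfLE (Γ.le_apply_apply x)))
    {x y z : P} (hxy : Γ x ≤ y) (hyz : Γ y ≤ z) (hxz : x ≤ z) :
    F.map (homOfLE hxz) =
      (φ.app x ≫ G.map (homOfLE hxy)) ≫ ψ.app y ≫ F.map (homOfLE hyz) := by
  have hxz' : Γ (Γ x) ≤ z := (Γ.monotone hxy).trans hyz
  have h₁ : F.map (homOfLE hxz) = (φ.app x ≫ ψ.app (Γ x)) ≫ F.map (homOfLE hxz') :=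
    (F.map_comp (homOfLE (Γ.le_apply_apply x)) (homOfLE hxz')).trans
      (congrArg (· ≫ F.map (homOfLE hxz')) (h x).symm)
  exact h₁.trans ((Category.assoc _ _ _).trans
    ((congrArg (φ.app x ≫ ·) (naturality_of_le ψ hxy hyz hxz')).trans (Category.assoc _ _ _).symm))

/-- The functor which an interleaving of `F` and `G` defines on the classifying preorder. -/
def functorOf {F G : P ⥤ M} (φ : F ⟶ Γ.functor ⋙ G) (ψ : G ⟶ Γ.functor ⋙ F)
    (h₁ : ∀ x, φ.app x ≫ ψ.app (Γ x) = F.map (homOfLE (Γ.le_apply_apply x)))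
    (h₂ : ∀ x, ψ.app x ≫ φ.app (Γ x) = G.map (homOfLE (Γ.le_apply_apply x))) :
    InterleavingPreorder Γ ⥤ M where
  obj
    | inl x => F.obj x
    | inr x => G.obj x
  map {a b} f := match a, b, f with
    | inl _, inl _, f => F.map (homOfLE (leOfHom f).1)
    | inl x, inr _, f => φ.app x ≫ G.map (homOfLE (leOfHom f).2)
    | inr x, inl _, f => ψ.app x ≫ F.map (homOfLE (leOfHom f).1)
    | inr _, inr _, f => G.map (homOfLE (leOfHom f).2)
  map_id a := by cases a <;> exact CategoryTheory.Functor.map_id _ _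
  map_comp {a b c} f g := by
    rcases a with x | x <;> rcases b with y | y <;> rcases c with z | z
    · exact F.map_comp _ _
    · exact naturality_of_le φ _ _ _
    · exact comp_of_le φ ψ h₁ _ _ _
    · exact (congrArg (φ.app x ≫ ·) (G.map_comp _ _)).trans (Category.assoc _ _ _).symm
    · exact (congrArg (ψ.app x ≫ ·) (F.map_comp _ _)).trans (Category.assoc _ _ _).symm
    · exact comp_of_le ψ φ h₂ _ _ _
    · exact naturality_of_le ψ _ _ _
    · exact G.map_comp _ _

end InterleavingPreorder

/-- The poset quotient of `InterleavingPreorder Γ`, which identifies the two copies of each fixed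
point of `Γ`. It is encoded as the image of `InterleavingPreorder.toProd`, a subposet of `P × P`. -/
abbrev InterleavingPoset : Type w := Set.range (InterleavingPreorder.toProd (Γ := Γ))

namespace InterleavingPoset

/-- The inclusion of the first copy of `P`. -/
def inl : P →o InterleavingPoset Γ where
  toFun x := ⟨(x, Γ x), .inl x, rfl⟩
  monotone' _ _ h := ⟨h, Γ.monotone h⟩

/-- The inclusion of the second copy of `P`. -/
def inr : P →o InterleavingPoset Γ where
  toFun x := ⟨(Γ x, x), .inr x, rfl⟩
  monotone' _ _ h := ⟨Γ.monotone h, h⟩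

/-- The left adjoint of `inl`. -/
def fst : InterleavingPoset Γ →o P where
  toFun z := z.1.1
  monotone' _ _ h := h.1

/-- The left adjoint of `inr`. -/
def snd : InterleavingPoset Γ →o P where
  toFun z := z.1.2
  monotone' _ _ h := h.2

lemma gc_fst_inl : GaloisConnection (fst Γ) (inl Γ) := by
  rintro ⟨_, a | a, rfl⟩ y
  · exact ⟨fun h => ⟨h, Γ.monotone h⟩, fun h => h.1⟩
  · exact ⟨fun h => ⟨h, ((Γ.le_apply a).trans h).trans (Γ.le_apply y)⟩, fun h => h.1⟩

lemma gc_snd_inr : GaloisConnection (snd Γ) (inr Γ) := by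
  rintro ⟨_, a | a, rfl⟩ y
  · exact ⟨fun h => ⟨((Γ.le_apply a).trans h).trans (Γ.le_apply y), h⟩, fun h => h.2⟩
  · exact ⟨fun h => ⟨Γ.monotone h, h⟩, fun h => h.2⟩

/-- The restrictions of a functor on `InterleavingPoset Γ` to the two copies of `P` are
interleaved. -/
lemma interleaved (H : InterleavingPoset Γ ⥤ M) :
    Interleaved Γ ((inl Γ).monotone.functor ⋙ H) ((inr Γ).monotone.functor ⋙ H) := by
  refine ⟨
    { app := fun x => H.map (homOfLE (?_ : inl Γ x ≤ inr Γ (Γ x)))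
      naturality := fun x y f => ?_ },
    { app := fun x => H.map (homOfLE (?_ : inr Γ x ≤ inl Γ (Γ x)))
      naturality := fun x y f => ?_ }, fun x => ?_, fun x => ?_⟩
  · exact ⟨Γ.le_apply_apply x, le_rfl⟩
  · exact (H.map_comp _ _).symm.trans (H.map_comp _ ((inr Γ).monotone.functor.map
      (Γ.functor.map f)))
  · exact ⟨le_rfl, Γ.le_apply_apply x⟩
  · exact (H.map_comp _ _).symm.trans (H.map_comp _ ((inl Γ).monotone.functor.map
      (Γ.functor.map f)))
  · exact (H.map_comp _ _).symm
  · exact (H.map_comp _ _).symm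

/-- A choice of representatives in `InterleavingPreorder Γ`. -/
noncomputable def rep : InterleavingPoset Γ ⥤ InterleavingPreorder Γ :=
  Monotone.functor (f := fun z : InterleavingPoset Γ => z.2.choose) (by
    intro z z' h
    change InterleavingPreorder.toProd z.2.choose ≤ InterleavingPreorder.toProd z'.2.choose
    rw [z.2.choose_spec, z'.2.choose_spec]
    exact h)

/-- Every interleaving is, up to isomorphism, the restriction of a functor on
`InterleavingPoset Γ`. -/
lemma exists_functor_of_interleaved {F G : P ⥤ M} (h : Interleaved Γ F G) :
    ∃ H : InterleavingPoset Γ ⥤ M, Nonempty ((inl Γ).monotone.functor ⋙ H ≅ F) ∧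
      Nonempty ((inr Γ).monotone.functor ⋙ H ≅ G) := by
  obtain ⟨φ, ψ, h₁, h₂⟩ := h
  let H := InterleavingPreorder.functorOf φ ψ h₁ h₂
  have e (a : InterleavingPreorder Γ) (z : InterleavingPoset Γ)
      (hz : InterleavingPreorder.toProd a = z) : (rep Γ).obj z ≅ a :=
    have h : InterleavingPreorder.toProd ((rep Γ).obj z) = InterleavingPreorder.toProd a :=
      z.2.choose_spec.trans hz.symm
    { hom := homOfLE (show _ ≤ InterleavingPreorder.toProd a from h.le)
      inv := homOfLE (show InterleavingPreorder.toProd a ≤ _ from h.ge) }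
  refine ⟨rep Γ ⋙ H, ⟨NatIso.ofComponents
    (fun x => H.mapIso (e (.inl x) (inl Γ x) rfl)) ?_⟩, ⟨NatIso.ofComponents
    (fun x => H.mapIso (e (.inr x) (inr Γ x) rfl)) ?_⟩⟩
  · intro x y f
    have hf : (.inl x : InterleavingPreorder Γ) ≤ .inl y := ⟨leOfHom f, Γ.monotone (leOfHom f)⟩
    exact (H.map_comp _ _).symm.trans (H.map_comp _ (homOfLE hf))
  · intro x y f
    have hf : (.inr x : InterleavingPreorder Γ) ≤ .inr y := ⟨Γ.monotone (leOfHom f), leOfHom f⟩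
    exact (H.map_comp _ _).symm.trans (H.map_comp _ (homOfLE hf))

variable {Γ} in
/-- Functoriality of the classifying poset in maps which commute with the translations. -/
def map {S : Type w} [PartialOrder S] {Γ' : Translation S} (α : S →o P)
    (hα : ∀ s, α (Γ' s) = Γ (α s)) : InterleavingPoset Γ' →o InterleavingPoset Γ where
  toFun z := ⟨(α z.1.1, α z.1.2), by
    obtain ⟨_, a | a, rfl⟩ := z
    · exact ⟨.inl (α a), Prod.ext rfl (hα a).symm⟩
    · exact ⟨.inr (α a), Prod.ext (hα a).symm rfl⟩⟩
  monotone' _ _ h := ⟨α.monotone h.1, α.monotone h.2⟩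

end InterleavingPoset

/-- Left Kan extension along a map `α` commuting with translations takes interleaved functors to
interleaved functors, after replacing them by suitable projectively cofibrant functors. -/
lemma exists_projCofibrant_interleaved_lan [ModelCategory M] [HasColimitsOfSize.{w, w} M]
    [IsGoodModelCategory.{w} M] {S : Type w} [PartialOrder S] {Γ' : Translation S} (α : S →o P)
    (hα : ∀ s, α (Γ' s) = Γ (α s)) {F G : S ⥤ M} (h : Interleaved Γ' F G) :
    ∃ X Y : S ⥤ M, ProjCofibrant X ∧ ProjCofibrant Y ∧ ZigzagEquiv (objWeq S M) X F ∧
      ZigzagEquiv (objWeq S M) Y G ∧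
      HomotopyInterleaved Γ (α.monotone.functor.lan.obj X) (α.monotone.functor.lan.obj Y) := by
  obtain ⟨H, ⟨eF⟩, ⟨eG⟩⟩ := InterleavingPoset.exists_functor_of_interleaved Γ' h
  obtain ⟨Z, p, hZ, hp⟩ := exists_projCofibrant_resolution H
  let β := InterleavingPoset.map α hα
  exact ⟨(InterleavingPoset.inl Γ').monotone.functor ⋙ Z,
    (InterleavingPoset.inr Γ').monotone.functor ⋙ Z,
    hZ.restrict (InterleavingPoset.gc_fst_inl Γ'), hZ.restrict (InterleavingPoset.gc_snd_inr Γ'),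
    ((ZigzagEquiv.of_hom p hp).restrict _).trans (.of_iso eF),
    ((ZigzagEquiv.of_hom p hp).restrict _).trans (.of_iso eG),
    (InterleavingPoset.inl Γ).monotone.functor ⋙ β.monotone.functor.lan.obj Z,
    (InterleavingPoset.inr Γ).monotone.functor ⋙ β.monotone.functor.lan.obj Z,
    .of_iso (lanBaseChangeIso (InterleavingPoset.gc_fst_inl Γ) (InterleavingPoset.gc_fst_inl Γ')
      (fun _ => rfl) Z),
    .of_iso (lanBaseChangeIso (InterleavingPoset.gc_snd_inr Γ) (InterleavingPoset.gc_snd_inr Γ')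
      (fun _ => rfl) Z),
    InterleavingPoset.interleaved Γ _⟩

end InterleavingPoset

/-! ### Approximations of interleaved functors -/

section Approximation

variable {P : Type w} [DistribLattice P] {M : Type u} [Category.{v} M] [ModelCategory M]

lemma HomotopyInterleaved.congr {Γ : Translation P} {F G F' G' : P ⥤ M}
    (h : HomotopyInterleaved Γ F G) (hF : ZigzagEquiv (objWeq P M) F F')
    (hG : ZigzagEquiv (objWeq P M) G G') : HomotopyInterleaved Γ F' G' := by
  obtain ⟨A, B, hA, hB, hAB⟩ := h
  exact ⟨A, B, hA.trans hF, hB.trans hG, hAB⟩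

/-- An automorphism of the lattice does not raise the join-dimension, as it carries reduced
decompositions into join-irreducible elements to such decompositions. -/
lemma jdim_orderIso_le (e : P ≃o P) (v : P) : jdim (e v) ≤ jdim v := by
  by_cases hv : IsMin v
  · have hev : IsMin (e v) := by rwa [OrderIso.isMin_apply]
    simp [jdim, hv, hev]
  · have hev : ¬ IsMin (e v) := by rwa [OrderIso.isMin_apply]
    simp only [jdim, hv, hev, if_false]
    refine le_iInf₂ fun k ⟨p, h₁, h₂, h₃⟩ => iInf₂_le k ⟨fun i => e (p i), ?_, ?_, ?_⟩
    · have : Set.range (fun i => e (p i)) = e '' Set.range p := Set.range_comp e p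
      rw [IsJoinDecomposition, this]
      exact e.isLUB_image'.2 h₁
    · intro i hi
      refine h₂ i (e.isLUB_image'.1 ?_)
      rwa [Set.image_image]
    · rintro i ⟨x, y, hx, hy, hxy⟩
      refine h₃ i ⟨e.symm x, e.symm y, ?_, ?_, ?_⟩
      · rwa [e.symm_apply_lt]
      · rwa [e.symm_apply_lt]
      · rw [← e.symm.map_sup, ← hxy, e.symm_apply_apply]

/-- A translation which does not raise the join-dimension, restricted to `P_{≤ k}`. -/
def Translation.dimLE (Γ : Translation P) (hΓ : ∀ v, jdim (Γ v) ≤ jdim v) (k : ℕ) :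
    Translation (DimLE P k) where
  toFun v := ⟨Γ v.1, (hΓ v.1).trans v.2⟩
  monotone' _ _ h := Γ.monotone h
  le_apply v := Γ.le_apply v.1

variable [HasColimitsOfSize.{w, w} M] [IsGoodModelCategory.{w} M]

/-- `T_k` takes `Γ`-interleaved functors to `Γ`-homotopy-interleaved ones, if the translation `Γ`
does not raise the join-dimension. -/
theorem Interleaved.codegreeApprox {Γ : Translation P} (hΓ : ∀ v, jdim (Γ v) ≤ jdim v)
    {F G : P ⥤ M} (h : Interleaved Γ F G) (k : ℕ) :
    HomotopyInterleaved Γ (codegreeApprox k F) (codegreeApprox k G) := by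
  have h' : Interleaved (Γ.dimLE hΓ k) ((dimLEIncl P k).monotone.functor ⋙ F)
      ((dimLEIncl P k).monotone.functor ⋙ G) := by
    obtain ⟨φ, ψ, h₁, h₂⟩ := h
    exact ⟨{ app := fun x => φ.app x.1, naturality := fun _ _ f => φ.naturality _ },
      { app := fun x => ψ.app x.1, naturality := fun _ _ f => ψ.naturality _ },
      fun x => h₁ x.1, fun x => h₂ x.1⟩
  obtain ⟨X, Y, hX, hY, hXF, hYG, hXY⟩ :=
    exists_projCofibrant_interleaved_lan Γ (dimLEIncl P k) (fun _ => rfl) h'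
  exact hXY.congr (codegreeApprox_zigzagEquiv_lan k F hX hXF).symm
    (codegreeApprox_zigzagEquiv_lan k G hY hYG).symm

theorem HomotopyInterleaved.codegreeApprox {Γ : Translation P} (hΓ : ∀ v, jdim (Γ v) ≤ jdim v)
    {F G : P ⥤ M} (h : HomotopyInterleaved Γ F G) (k : ℕ) :
    HomotopyInterleaved Γ (codegreeApprox k F) (codegreeApprox k G) := by
  obtain ⟨A, B, hA, hB, hAB⟩ := h
  exact (hAB.codegreeApprox hΓ k).congr (codegreeApprox_congr k hA) (codegreeApprox_congr k hB)

end Approximation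

/-! ### The multiplicative family -/

/-- The translation `Λ_ε` of the orthant, as an order isomorphism. -/
noncomputable def multOrderIso (n : ℕ) (ε : ℝ≥0) : Orthant n ≃o Orthant n where
  toFun := (multFamily n).trans ε
  invFun v i := v i * (expNN ε)⁻¹
  left_inv v := funext fun i =>
    mul_inv_cancel_right₀ (zero_lt_one.trans_le (one_le_expNN ε)).ne' (v i)
  right_inv v := funext fun i =>
    inv_mul_cancel_right₀ (zero_lt_one.trans_le (one_le_expNN ε)).ne' (v i)
  map_rel_iff' :=
    forall_congr' fun _ => mul_le_mul_iff_left₀ (zero_lt_one.trans_le (one_le_expNN ε))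

end PosetCocalculus

open PosetCocalculus
theorem mainTheorem5 {M : Type u} [Category.{v} M] [ModelCategory M]
    [HasColimitsOfSize.{0, 0} M] [IsGoodModelCategory.{0} M] (n : ℕ) (F G : Orthant n ⥤ M) :
    (∀ (k : ℕ) (ε : ℝ≥0), Interleaved ((multFamily n).trans ε) F G →
      HomotopyInterleaved ((multFamily n).trans ε) (codegreeApprox k F) (codegreeApprox k G)) ∧
    (∀ k : ℕ, multDist (codegreeApprox k F) (codegreeApprox k G) ≤ multDist F G) ∧
    (∀ k : ℕ, multDist (codegreeApprox k F) (codegreeApprox k G) ≤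
      multDist (codegreeApprox (k + 1) F) (codegreeApprox (k + 1) G)) := by
  have hΛ (ε : ℝ≥0) (v : Orthant n) : jdim ((multFamily n).trans ε v) ≤ jdim v :=
    jdim_orderIso_le (multOrderIso n ε) v
  refine ⟨fun k ε h => h.codegreeApprox (hΛ ε) k,
    fun k => le_iInf₂ fun ε h => iInf₂_le ε (h.codegreeApprox (hΛ ε) k),
    fun k => le_iInf₂ fun ε h => iInf₂_le ε ?_⟩
  -- `T_k` is applied to the homotopy interleaving of `T_{k+1} F` and `T_{k+1} G`.
  exact (h.codegreeApprox (hΛ ε) k).congr (codegreeApprox_codegreeApprox k.le_succ F)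
    (codegreeApprox_codegreeApprox k.le_succ G)
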